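/- Let $H$ be a real Hilbert space and let $C\subseteq H$ be closed and convex. Let $f:C\to C$ be a contraction with constant $\alpha\in(0,1)$, that is, $\|f(x)-f(y)\|\le\alpha\|x-y\|$ for all $x,y\in C$. Let $A:H\to H$ be a bounded linear operator that is strongly positive with coefficient $\bar\gamma>0$, that is, $\langle Ax,x\rangle\ge\bar\gamma\|x\|^2$ for all $x\in H$. Let $0<\gamma<\bar\gamma/\alpha$. Let $T_i:C\to C$ ($i\ge1$) be nonexpansive mappings, that is, $\|T_ix-T_iy\|\le\|x-y\|$ for all $x,y\in C$, with $F:=\bigcap_{i\ge1}\{p\in C: T_ip=p\}\neq\emptyset$. Let $(\theta_i)_{i\ge1}$ be real numbers with $0<\theta_i\le b<1$ for all $i\ge1$ and some constant $b$. For $n\ge0$ define mappings $U_{n,k}:C\to C$ by $U_{n,n+1}=I$ and $$U_{n,k}=\theta_kT_kU_{n,k+1}+(1-\theta_k)I\qquad(k=n,n-1,\dots,1),$$ and put $W_n=U_{n,1}$ (the Shimoji–Takahashi $W_n$-mapping; $W_0=I$). Let $(\alpha_n)_{n\ge0},(\beta_n)_{n\ge0},(\gamma_n)_{n\ge0},(\delta_n)_{n\ge0}$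 be sequences in $[0,1]$ such that - (C1) $\lim_{n\to\infty}\alpha_n=0$ and $\sum_{n=1}^\infty\alpha_n=\infty$; - (C2) $0<\liminf_{n\to\infty}\delta_n\le\limsup_{n\to\infty}\delta_n<1$; - (C3) $\sum_{n=1}^\infty|\gamma_n-\gamma_{n-1}|<\infty$; - (C4) $\sum_{n=1}^\infty|\alpha_n-\alpha_{n-1}|<\infty$; - (C5) $\sum_{n=1}^\infty|\beta_n-\beta_{n-1}|<\infty$; - (C6) there is $d\in(0,1)$ with $(1+\beta_n)\gamma_n-2\beta_n>d$ for all $n\ge0$. Let $x_0\in C$ be arbitrary and, for $n\ge0$, let $$z_n=\gamma_nx_n+(1-\gamma_n)W_nx_n,\qquad y_n=\beta_nx_n+(1-\beta_n)W_nz_n,$$ $$x_{n+1}=P_C\bigl[\alpha_n\gamma f(x_n)+\delta_nx_n+((1-\delta_n)I-\alpha_nA)y_n\bigr],$$ where $P_C$ is the metric (nearest point) projection of $H$ onto $C$. Then there is exactly one $q\in F$ with $\langle\gamma f(q)-Aq,\,p-q\rangle\le0$ for all $p\in F$, and $(x_n)$ converges strongly to this $q$. -/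

import Mathlib

open Filter Topology

/-- The metric (nearest point) projection onto `C`: a point of `C` at minimal distance from `u`.
For nonempty closed convex `C` in a Hilbert space this point exists and is unique (see
`metricProj_mem`, `metricProj_le`, `eq_metricProj` below). If no nearest point exists, the value
is `u`, by convention. -/
noncomputable def metricProj {H : Type*} [NormedAddCommGroup H] (C : Set H) (u : H) : H :=
  open Classical in
  if h : ∃ p ∈ C, ∀ w ∈ C, ‖u - p‖ ≤ ‖u - w‖ then h.choose else u

/-- The maps of Shimoji and Takahashi, counted by the number `m` of maps that are composed:
starting from the identity (`m = 0`),
`x ↦ θ_k T_k (shimojiAux m (k+1) x) + (1 - θ_k) x`. -/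
def shimojiAux {H : Type*} [AddCommGroup H] [Module ℝ H]
    (T : ℕ → H → H) (θ : ℕ → ℝ) : ℕ → ℕ → H → H
  | 0, _, x => x
  | m + 1, k, x => θ k • T k (shimojiAux T θ m (k + 1) x) + (1 - θ k) • x

/-- `U_{n,k}`, for `1 ≤ k ≤ n + 1`: one has `U_{n,n+1} = I` and
`U_{n,k} = θ_k T_k U_{n,k+1} + (1 - θ_k) I` for `k ≤ n`
(see `shimojiU_top` and `shimojiU_of_le`). -/
def shimojiU {H : Type*} [AddCommGroup H] [Module ℝ H]
    (T : ℕ → H → H) (θ : ℕ → ℝ) (n k : ℕ) : H → H :=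
  shimojiAux T θ (n + 1 - k) k

/-- The `W_n`-mapping `W_n = U_{n,1}` generated by `T_1, …, T_n` and `θ_1, …, θ_n`;
in particular `W_0 = I`. -/
def shimojiW {H : Type*} [AddCommGroup H] [Module ℝ H]
    (T : ℕ → H → H) (θ : ℕ → ℝ) (n : ℕ) : H → H :=
  shimojiU T θ n 1

/-- The set `F = ⋂_{i ≥ 1} F(T_i)` of common fixed points in `C`. -/
def commonFixedPoints {H : Type*} (C : Set H) (T : ℕ → H → H) : Set H :=
  {p | p ∈ C ∧ ∀ i, 1 ≤ i → T i p = p}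

theorem shimojiU_top {H : Type*} [AddCommGroup H] [Module ℝ H]
    (T : ℕ → H → H) (θ : ℕ → ℝ) (n : ℕ) (x : H) : shimojiU T θ n (n + 1) x = x := by
  simp [shimojiU, shimojiAux]

theorem shimojiU_of_le {H : Type*} [AddCommGroup H] [Module ℝ H]
    (T : ℕ → H → H) (θ : ℕ → ℝ) {n k : ℕ} (hk : k ≤ n) (x : H) :
    shimojiU T θ n k x = θ k • T k (shimojiU T θ n (k + 1) x) + (1 - θ k) • x := by
  have h : n + 1 - k = (n + 1 - (k + 1)) + 1 := by omega
  unfold shimojiU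
  rw [h, shimojiAux]

theorem exists_nearest {H : Type*} [NormedAddCommGroup H] [InnerProductSpace ℝ H]
    [CompleteSpace H] {C : Set H} (hne : C.Nonempty) (hcl : IsClosed C) (hcv : Convex ℝ C)
    (u : H) : ∃ p ∈ C, ∀ w ∈ C, ‖u - p‖ ≤ ‖u - w‖ := by
  obtain ⟨p, hp, hmin⟩ := exists_norm_eq_iInf_of_complete_convex hne hcl.isComplete hcv u
  refine ⟨p, hp, fun w hw => ?_⟩
  rw [hmin]
  exact ciInf_le ⟨0, by rintro _ ⟨a, rfl⟩; exact norm_nonneg _⟩ (⟨w, hw⟩ : C)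

theorem metricProj_mem {H : Type*} [NormedAddCommGroup H] [InnerProductSpace ℝ H]
    [CompleteSpace H] {C : Set H} (hne : C.Nonempty) (hcl : IsClosed C) (hcv : Convex ℝ C)
    (u : H) : metricProj C u ∈ C := by
  have h := exists_nearest hne hcl hcv u
  rw [metricProj, dif_pos h]
  exact h.choose_spec.1

theorem metricProj_le {H : Type*} [NormedAddCommGroup H] [InnerProductSpace ℝ H]
    [CompleteSpace H] {C : Set H} (hne : C.Nonempty) (hcl : IsClosed C) (hcv : Convex ℝ C)
    (u : H) {w : H} (hw : w ∈ C) : ‖u - metricProj C u‖ ≤ ‖u - w‖ := by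
  have h := exists_nearest hne hcl hcv u
  rw [metricProj, dif_pos h]
  exact h.choose_spec.2 w hw

theorem inner_nearest_nonpos {H : Type*} [NormedAddCommGroup H] [InnerProductSpace ℝ H]
    {C : Set H} (hcv : Convex ℝ C) {u p : H} (hp : p ∈ C)
    (hmin : ∀ w ∈ C, ‖u - p‖ ≤ ‖u - w‖) : ∀ w ∈ C, inner ℝ (u - p) (w - p) ≤ 0 := by
  refine (norm_eq_iInf_iff_real_inner_le_zero hcv hp).1 (le_antisymm ?_ ?_)
  · have : Nonempty C := ⟨⟨p, hp⟩⟩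
    exact le_ciInf fun w => hmin w w.2
  · exact ciInf_le ⟨0, by rintro _ ⟨a, rfl⟩; exact norm_nonneg _⟩ (⟨p, hp⟩ : C)

theorem eq_metricProj {H : Type*} [NormedAddCommGroup H] [InnerProductSpace ℝ H]
    [CompleteSpace H] {C : Set H} (hcl : IsClosed C) (hcv : Convex ℝ C)
    {u p : H} (hp : p ∈ C) (hmin : ∀ w ∈ C, ‖u - p‖ ≤ ‖u - w‖) : p = metricProj C u := by
  have hne : C.Nonempty := ⟨p, hp⟩
  have hq := metricProj_mem hne hcl hcv u
  have h1 := inner_nearest_nonpos hcv hp hmin _ hq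
  have h2 := inner_nearest_nonpos hcv hq (fun w hw => metricProj_le hne hcl hcv u hw) _ hp
  generalize metricProj C u = q at h1 h2
  have h3 : inner ℝ (q - p) (q - p) = inner ℝ (u - p) (q - p) + inner ℝ (u - q) (p - q) := by
    have e : p - q = -(q - p) := by abel
    rw [e, inner_neg_right, ← sub_eq_add_neg, ← inner_sub_left]
    congr 1
    abel
  have h4 : ‖q - p‖ ^ 2 ≤ 0 := by
    rw [← real_inner_self_eq_norm_sq, h3]
    linarith
  have h5 : ‖q - p‖ = 0 := pow_eq_zero_iff two_ne_zero |>.1 (le_antisymm h4 (sq_nonneg _))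
  exact (sub_eq_zero.1 (norm_eq_zero.1 h5)).symm

/-! Put `m = γbar - γ * a`. The operator `A - γ f` is Lipschitz and `m`-strongly monotone on `C`, so
the variational inequality over the closed convex set `F` has exactly one solution `q`. With `e = γ
f q - A q`, expanding the squared distance gives `‖x (n+1) - q‖² ≤ (1 - 2mα_n) ‖x n - q‖² - δ_n(1 -
δ_n) ‖x n - y n‖² + α_n τ_n`, where `τ` is bounded and equals `2⟨e, x n - q⟩` up to terms vanishing
with `x n - y n` and `α_n`.

The negative term makes asymptotic regularity unnecessary (`eventually_mul_sub_le`). Where `‖x n - y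
n‖²` dominates a multiple of `α_n`, it absorbs `α_n τ_n`. Along any ultrafilter where it does not,
`x n - y n → 0`, hence `W_n x_n - x_n → 0`, hence `T_k x_n - x_n → 0` for each `k`
(`tendsto_sub_of_shimojiW`). The weak limit then lies in `F` by demiclosedness, and the variational
inequality gives `lim τ ≤ 0`. A real recursion lemma concludes. -/

theorem isClosed_commonFixedPoints {H : Type*} [NormedAddCommGroup H] {C : Set H} (hcl : IsClosed C)
    {T : ℕ → H → H}
    (hT : ∀ i, 1 ≤ i → ∀ x ∈ C, ∀ y ∈ C, ‖T i x - T i y‖ ≤ ‖x - y‖) :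
    IsClosed (commonFixedPoints C T) := by
  refine isClosed_of_closure_subset fun p hp => ?_
  have hpC : p ∈ C := hcl.closure_subset_iff.2 (fun _ h => h.1) hp
  refine ⟨hpC, fun i hi => ?_⟩
  refine sub_eq_zero.1 (norm_le_zero_iff.1 (le_of_forall_pos_le_add fun ε hε => ?_))
  obtain ⟨r, hr, hd⟩ := Metric.mem_closure_iff.1 hp (ε / 2) (half_pos hε)
  have h1 := hT i hi p hpC r hr.1
  rw [hr.2 i hi] at h1
  rw [dist_eq_norm] at hd
  have h2 := norm_sub_le_norm_sub_add_norm_sub (T i p) r p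
  rw [norm_sub_rev r p] at h2
  linarith

/-! ### Hilbert space geometry: projections, weak limits, variational inequalities. -/

section InnerProduct

variable {H : Type*} [NormedAddCommGroup H] [InnerProductSpace ℝ H]

theorem norm_sq_convexComb (t : ℝ) (u v : H) :
    ‖t • u + (1 - t) • v‖ ^ 2 = t * ‖u‖ ^ 2 + (1 - t) * ‖v‖ ^ 2 - t * (1 - t) * ‖u - v‖ ^ 2 := by
  rw [norm_add_sq_real, norm_sub_sq_real, norm_smul, norm_smul, real_inner_smul_left,
    real_inner_smul_right, mul_pow, mul_pow, Real.norm_eq_abs, Real.norm_eq_abs, sq_abs, sq_abs]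
  ring

theorem norm_convexComb_le {t : ℝ} (h0 : 0 ≤ t) (h1 : t ≤ 1) {u v : H} {r : ℝ}
    (hu : ‖u‖ ≤ r) (hv : ‖v‖ ≤ r) : ‖t • u + (1 - t) • v‖ ≤ r := by
  have := (convex_closedBall (0 : H) r) (mem_closedBall_zero_iff.2 hu) (mem_closedBall_zero_iff.2 hv)
    h0 (sub_nonneg.2 h1) (add_sub_cancel t 1)
  exact mem_closedBall_zero_iff.1 this

theorem inner_metricProj_nonpos [CompleteSpace H]
    {C : Set H} (hcl : IsClosed C) (hcv : Convex ℝ C) (u : H) {w : H}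
    (hw : w ∈ C) : inner ℝ (u - metricProj C u) (w - metricProj C u) ≤ 0 :=
  inner_nearest_nonpos hcv (metricProj_mem ⟨w, hw⟩ hcl hcv u)
    (fun _ h => metricProj_le ⟨w, hw⟩ hcl hcv u h) w hw

theorem norm_metricProj_sub_le [CompleteSpace H] {C : Set H} (hne : C.Nonempty) (hcl : IsClosed C)
    (hcv : Convex ℝ C) (u v : H) : ‖metricProj C u - metricProj C v‖ ≤ ‖u - v‖ := by
  have h1 := inner_metricProj_nonpos hcl hcv u (metricProj_mem hne hcl hcv v)
  have h2 := inner_metricProj_nonpos hcl hcv v (metricProj_mem hne hcl hcv u)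
  generalize metricProj C u = p at *
  generalize metricProj C v = q at *
  have h3 : ‖p - q‖ ^ 2 = inner ℝ (u - v) (p - q) + inner ℝ (u - p) (q - p)
      + inner ℝ (v - q) (p - q) := by
    rw [← real_inner_self_eq_norm_sq, ← neg_sub p q, inner_neg_right, ← sub_eq_add_neg,
      ← inner_sub_left, ← inner_add_left]
    congr 1
    abel
  have h4 := real_inner_le_norm (u - v) (p - q)
  rcases (norm_nonneg (p - q)).eq_or_lt with h | h
  · rw [← h]; positivity
  · refine le_of_mul_le_mul_right (?_ : _ * ‖p - q‖ ≤ _ * ‖p - q‖) h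
    nlinarith

theorem metricProj_of_mem [CompleteSpace H]
    {C : Set H} (hcl : IsClosed C) (hcv : Convex ℝ C) {u : H} (hu : u ∈ C) :
    metricProj C u = u :=
  (eq_metricProj hcl hcv hu fun w _ => by simp).symm

theorem norm_metricProj_sub_le_of_mem [CompleteSpace H]
    {C : Set H} (hcl : IsClosed C) (hcv : Convex ℝ C) (u : H)
    {p : H} (hp : p ∈ C) : ‖metricProj C u - p‖ ≤ ‖u - p‖ := by
  simpa [metricProj_of_mem hcl hcv hp] using norm_metricProj_sub_le ⟨p, hp⟩ hcl hcv u p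

/-- Bounded families in a Hilbert space converge weakly along ultrafilters. -/
theorem exists_weak_limit_ultrafilter [CompleteSpace H]
    {ι : Type*} (U : Ultrafilter ι) (x : ι → H) {R : ℝ}
    (hR : ∀ n, ‖x n‖ ≤ R) :
    ∃ p, ∀ v, Tendsto (fun n => inner ℝ (x n) v) U (𝓝 (inner ℝ p v)) := by
  let φ : ι → WeakDual ℝ H := fun n => StrongDual.toWeakDual (InnerProductSpace.toDual ℝ H (x n))
  have hc := WeakDual.isCompact_closedBall (𝕜 := ℝ) (0 : StrongDual ℝ H) R
  obtain ⟨ψ, -, hψ⟩ := hc.ultrafilter_le_nhds (U.map φ) (by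
    refine le_principal_iff.2 (mem_map.2 (Filter.Eventually.of_forall fun n => ?_))
    change InnerProductSpace.toDual ℝ H (x n) ∈ Metric.closedBall _ _
    simpa using hR n)
  refine ⟨(InnerProductSpace.toDual ℝ H).symm (WeakDual.toStrongDual ψ), fun v => ?_⟩
  have h1 : Tendsto φ U (𝓝 ψ) := hψ
  have h2 := ((WeakDual.eval_continuous v).tendsto ψ).comp h1
  rw [InnerProductSpace.toDual_symm_apply]
  exact h2

/-- The half-space inequality at the projection `r` of `p` survives the weak limit; tested at `p`
itself it reads `‖p - r‖² ≤ 0`. -/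
theorem mem_of_weak_limit [CompleteSpace H]
    {ι : Type*} {l : Filter ι} [l.NeBot] {C : Set H} (hcl : IsClosed C)
    (hcv : Convex ℝ C) {x : ι → H} (hx : ∀ n, x n ∈ C) {p : H}
    (hp : ∀ v, Tendsto (fun n => inner ℝ (x n) v) l (𝓝 (inner ℝ p v))) : p ∈ C := by
  obtain ⟨n₀⟩ := l.nonempty_of_neBot
  have hne : C.Nonempty := ⟨_, hx n₀⟩
  set r := metricProj C p with hr
  have h1 : Tendsto (fun n => inner ℝ (x n) (p - r) - inner ℝ r (p - r)) l
      (𝓝 (inner ℝ p (p - r) - inner ℝ r (p - r))) := (hp _).sub_const _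
  have h2 : inner ℝ p (p - r) - inner ℝ r (p - r) ≤ 0 := by
    refine le_of_tendsto' h1 fun n => ?_
    rw [← inner_sub_left, real_inner_comm]
    exact inner_metricProj_nonpos hcl hcv p (hx n)
  rw [← inner_sub_left, real_inner_self_eq_norm_sq] at h2
  have h3 : ‖p - r‖ = 0 := pow_eq_zero_iff two_ne_zero |>.1 (le_antisymm h2 (sq_nonneg _))
  rw [sub_eq_zero.1 (norm_eq_zero.1 h3)]
  exact metricProj_mem hne hcl hcv p

/-- Demiclosedness of `I - T` at `0`. -/
theorem fixed_of_weak_limit {ι : Type*} {l : Filter ι} [l.NeBot] {T : H → H} {x : ι → H} {p : H}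
    {R : ℝ} (hR : ∀ n, ‖x n‖ ≤ R) (hT : ∀ n, ‖T (x n) - T p‖ ≤ ‖x n - p‖)
    (hTx : Tendsto (fun n => ‖T (x n) - x n‖) l (𝓝 0))
    (hp : ∀ v, Tendsto (fun n => inner ℝ (x n) v) l (𝓝 (inner ℝ p v))) : T p = p := by
  -- Opial's argument: `‖x n - T p‖²` is expanded exactly around `p`, and bounded above through `T
  -- (x n)`. Comparing the two bounds `‖p - T p‖²` by this expression, whose limit is `0`.
  have h1 : Tendsto (fun n => ‖T (x n) - x n‖ ^ 2 + 2 * ‖T (x n) - x n‖ * (R + ‖p‖)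
      - 2 * (inner ℝ (x n) (p - T p) - inner ℝ p (p - T p))) l
      (𝓝 (0 ^ 2 + 2 * 0 * (R + ‖p‖) - 2 * (inner ℝ p (p - T p) - inner ℝ p (p - T p)))) :=
    ((hTx.pow 2).add ((hTx.const_mul 2).mul_const _)).sub
      (((hp _).sub_const _).const_mul 2)
  have h2 : ‖p - T p‖ ^ 2 ≤ 0 ^ 2 + 2 * 0 * (R + ‖p‖)
      - 2 * (inner ℝ p (p - T p) - inner ℝ p (p - T p)) := by
    refine ge_of_tendsto' h1 fun n => ?_
    have e1 : x n - T p = (x n - p) + (p - T p) := by abel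
    have e2 : x n - T p = (x n - T (x n)) + (T (x n) - T p) := by abel
    have e3 := norm_add_sq_real (x n - p) (p - T p)
    rw [← e1, inner_sub_left] at e3
    have e4 : ‖x n - T p‖ ≤ ‖T (x n) - x n‖ + ‖x n - p‖ := by
      rw [e2]
      refine (norm_add_le _ _).trans ?_
      rw [norm_sub_rev]
      exact add_le_add_right (hT n) _
    have e5 : ‖x n - p‖ ≤ R + ‖p‖ := (norm_sub_le _ _).trans (add_le_add_left (hR n) _)
    have e6 := pow_le_pow_left₀ (norm_nonneg _) e4 2
    have e7 := mul_le_mul_of_nonneg_left e5 (norm_nonneg (T (x n) - x n))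
    nlinarith
  have h3 : ‖p - T p‖ ^ 2 ≤ 0 := by linarith
  have h4 : ‖p - T p‖ = 0 := pow_eq_zero_iff two_ne_zero |>.1 (le_antisymm h3 (sq_nonneg _))
  exact (sub_eq_zero.1 (norm_eq_zero.1 h4)).symm

/-- For `w = s u + (1-s) v`, the function `s‖r - u‖² + (1-s)‖r - v‖²` of `r` is `‖r - w‖²` plus a
constant. It does not increase from `r = w` to `r = T w`, so `T w = w`. -/
theorem convex_commonFixedPoints {C : Set H} (hcv : Convex ℝ C) {T : ℕ → H → H}
    (hT : ∀ i, 1 ≤ i → ∀ x ∈ C, ∀ y ∈ C, ‖T i x - T i y‖ ≤ ‖x - y‖) :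
    Convex ℝ (commonFixedPoints C T) := by
  intro u hu v hv s t hs ht hst
  obtain rfl : t = 1 - s := by linarith
  have hC := hcv hu.1 hv.1 hs ht hst
  refine ⟨hC, fun i hi => ?_⟩
  set w := s • u + (1 - s) • v with hw
  have key : ∀ r : H, ‖r - w‖ ^ 2 = s * ‖r - u‖ ^ 2 + (1 - s) * ‖r - v‖ ^ 2
      - s * (1 - s) * ‖v - u‖ ^ 2 := fun r => by
    have h := norm_sq_convexComb s (r - u) (r - v)
    rw [sub_sub_sub_cancel_left] at h
    rw [← h]
    congr 2
    rw [hw]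
    module
  have h1 := hT i hi w hC u hu.1
  have h2 := hT i hi w hC v hv.1
  rw [hu.2 i hi] at h1
  rw [hv.2 i hi] at h2
  have h3 := key (T i w)
  have h4 := key w
  rw [sub_self, norm_zero] at h4
  have h5 := mul_le_mul_of_nonneg_left (pow_le_pow_left₀ (norm_nonneg _) h1 2) hs
  have h6 := mul_le_mul_of_nonneg_left (pow_le_pow_left₀ (norm_nonneg _) h2 2) ht
  have h7 : ‖T i w - w‖ ^ 2 ≤ 0 := by linarith
  have h8 : ‖T i w - w‖ = 0 := pow_eq_zero_iff two_ne_zero |>.1 (le_antisymm h7 (sq_nonneg _))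
  exact sub_eq_zero.1 (norm_eq_zero.1 h8)

/-- Existence for variational inequalities with a Lipschitz, strongly monotone operator. -/
theorem exists_variational_solution [CompleteSpace H]
    {F : Set H} (hne : F.Nonempty) (hcl : IsClosed F)
    (hcv : Convex ℝ F) (G : H → H) {m L : ℝ} (hm : 0 < m) (hmL : m ≤ L)
    (hmono : ∀ u ∈ F, ∀ v ∈ F, m * ‖u - v‖ ^ 2 ≤ inner ℝ (G u - G v) (u - v))
    (hlip : ∀ u ∈ F, ∀ v ∈ F, ‖G u - G v‖ ≤ L * ‖u - v‖) :
    ∃ q ∈ F, ∀ p ∈ F, 0 ≤ inner ℝ (G q) (p - q) := by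
  have hL : 0 < L := hm.trans_le hmL
  -- This step size minimises `1 - 2cm + c²L²`, the bound on the squared Lipschitz constant of `u ↦
  -- u - c G u`; the minimum is `K`.
  set c : ℝ := m / L ^ 2 with hc
  have hcpos : 0 < c := by positivity
  let Φ : F → F := fun u => ⟨metricProj F (u - c • G u), metricProj_mem hne hcl hcv _⟩
  set K : ℝ := 1 - m ^ 2 / L ^ 2 with hK
  have hK0 : 0 ≤ K := by
    rw [hK, sub_nonneg, div_le_one (by positivity)]
    exact pow_le_pow_left₀ hm.le hmL 2
  have hK1 : K < 1 := by rw [hK]; linarith [show 0 < m ^ 2 / L ^ 2 by positivity]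
  have hΦ : ContractingWith (√K).toNNReal Φ := by
    refine ⟨?_, LipschitzWith.of_dist_le_mul fun u v => ?_⟩
    · rw [Real.toNNReal_lt_one, Real.sqrt_lt' one_pos]
      linarith
    · rw [Subtype.dist_eq, Subtype.dist_eq, dist_eq_norm, dist_eq_norm]
      refine (norm_metricProj_sub_le hne hcl hcv _ _).trans ?_
      rw [Real.coe_toNNReal _ (Real.sqrt_nonneg K)]
      refine abs_le_of_sq_le_sq' ?_ (by positivity) |>.2
      rw [mul_pow, Real.sq_sqrt hK0]
      have e : (u : H) - c • G u - (v - c • G v) = (u - v) - c • (G u - G v) := by module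
      rw [e, norm_sub_sq_real, real_inner_smul_right, norm_smul, Real.norm_of_nonneg hcpos.le,
        mul_pow, real_inner_comm]
      have h1 := hmono u u.2 v v.2
      have h2 := pow_le_pow_left₀ (norm_nonneg _) (hlip u u.2 v v.2) 2
      rw [mul_pow] at h2
      have h3 := mul_le_mul_of_nonneg_left h1 hcpos.le
      have h4 := mul_le_mul_of_nonneg_left h2 (sq_nonneg c)
      have h5 : c ^ 2 * L ^ 2 = m ^ 2 / L ^ 2 := by rw [hc]; field_simp
      have h6 : c * m = m ^ 2 / L ^ 2 := by rw [hc]; field_simp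
      rw [← mul_assoc] at h3 h4
      rw [h6] at h3
      rw [h5] at h4
      rw [hK]
      linarith
  have : CompleteSpace F := hcl.completeSpace_coe
  have : Nonempty F := hne.to_subtype
  obtain ⟨q, hq⟩ : ∃ q : F, Φ q = q := ⟨_, hΦ.fixedPoint_isFixedPt⟩
  have hfix : metricProj F ((q : H) - c • G q) = q := congrArg Subtype.val hq
  refine ⟨q, q.2, fun p hp => ?_⟩
  have h := inner_metricProj_nonpos hcl hcv ((q : H) - c • G q) hp
  rw [hfix, sub_sub_cancel_left, inner_neg_left, real_inner_smul_left, Left.neg_nonpos_iff] at h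
  exact nonneg_of_mul_nonneg_right h hcpos

end InnerProduct

/-- A sequence that is eventually contracted by factors `1 - a n` with divergent `∑ a n`, up to
errors that are asymptotically `o (a n)`, tends to `0`. -/
theorem tendsto_zero_of_eventually_le {s a : ℕ → ℝ} (hs : ∀ n, 0 ≤ s n)
    (ha1 : ∀ᶠ n in atTop, a n ≤ 1)
    (hdiv : Tendsto (fun N => ∑ n ∈ Finset.range N, a n) atTop atTop)
    (h : ∀ ε > 0, ∀ᶠ n in atTop, s (n + 1) ≤ (1 - a n) * s n + a n * ε) :
    Tendsto s atTop (𝓝 0) := by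
  rw [Metric.tendsto_atTop]
  intro ε hε
  obtain ⟨N, hN⟩ := eventually_atTop.1 (ha1.and (h (ε / 2) (half_pos hε)))
  have hexp : Tendsto (fun n => s N * Real.exp (∑ k ∈ Finset.range N, a k) *
      Real.exp (-∑ k ∈ Finset.range n, a k)) atTop (𝓝 0) := by
    simpa using (Real.tendsto_exp_neg_atTop_nhds_zero.comp hdiv).const_mul
      (s N * Real.exp (∑ k ∈ Finset.range N, a k))
  -- The exponential part is propagated by `1 - a ≤ exp (-a)`, while `ε / 2` is reproduced as `(1 -
  -- a) ε / 2 + a ε / 2`.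
  have key : ∀ n, N ≤ n → s n ≤ s N * Real.exp (∑ k ∈ Finset.range N, a k) *
      Real.exp (-∑ k ∈ Finset.range n, a k) + ε / 2 := by
    intro n hn
    induction n, hn using Nat.le_induction with
    | base =>
      rw [mul_assoc, ← Real.exp_add, add_neg_cancel, Real.exp_zero, mul_one]
      linarith
    | succ n hn ih =>
      obtain ⟨h1, h2⟩ := hN n hn
      rw [Finset.sum_range_succ, neg_add, Real.exp_add]
      set B := s N * Real.exp (∑ k ∈ Finset.range N, a k) *
        Real.exp (-∑ k ∈ Finset.range n, a k) with hB
      have hB0 : 0 ≤ B := mul_nonneg (mul_nonneg (hs N) (Real.exp_pos _).le) (Real.exp_pos _).le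
      have h3 := mul_le_mul_of_nonneg_left ih (sub_nonneg.2 h1)
      have h4 := mul_le_mul_of_nonneg_left (Real.one_sub_le_exp_neg (a n)) hB0
      rw [← mul_assoc, ← hB]
      nlinarith
  obtain ⟨M, hM⟩ := eventually_atTop.1 (hexp.eventually_lt_const (half_pos hε))
  refine ⟨max N M, fun n hn => ?_⟩
  rw [Real.dist_eq, sub_zero, abs_of_nonneg (hs n)]
  linarith [key n (le_of_max_le_left hn), hM n (le_of_max_le_right hn)]

/-! ### The `W_n`-mappings. -/

section Shimoji

variable {H : Type*} [NormedAddCommGroup H] [InnerProductSpace ℝ H]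

theorem shimojiAux_mem {C : Set H} (hcv : Convex ℝ C) {T : ℕ → H → H}
    (hTC : ∀ i, 1 ≤ i → Set.MapsTo (T i) C C) {θ : ℕ → ℝ}
    (hθ : ∀ i, 1 ≤ i → 0 ≤ θ i ∧ θ i ≤ 1) {x : H} (hx : x ∈ C) (m k : ℕ) (hk : 1 ≤ k) :
    shimojiAux T θ m k x ∈ C := by
  induction m generalizing k with
  | zero => exact hx
  | succ m ih =>
    exact hcv (hTC k hk (ih (k + 1) (by omega))) hx (hθ k hk).1 (sub_nonneg.2 (hθ k hk).2)
      (add_sub_cancel _ _)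

theorem norm_shimojiAux_sub_le {C : Set H} (hcv : Convex ℝ C) {T : ℕ → H → H}
    (hTC : ∀ i, 1 ≤ i → Set.MapsTo (T i) C C)
    (hT : ∀ i, 1 ≤ i → ∀ x ∈ C, ∀ y ∈ C, ‖T i x - T i y‖ ≤ ‖x - y‖) {θ : ℕ → ℝ}
    (hθ : ∀ i, 1 ≤ i → 0 ≤ θ i ∧ θ i ≤ 1) {x y : H} (hx : x ∈ C) (hy : y ∈ C)
    (m k : ℕ) (hk : 1 ≤ k) :
    ‖shimojiAux T θ m k x - shimojiAux T θ m k y‖ ≤ ‖x - y‖ := by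
  induction m generalizing k with
  | zero => exact le_rfl
  | succ m ih =>
    have hk' : 1 ≤ k + 1 := by omega
    have e : shimojiAux T θ (m + 1) k x - shimojiAux T θ (m + 1) k y
        = θ k • (T k (shimojiAux T θ m (k + 1) x) - T k (shimojiAux T θ m (k + 1) y))
          + (1 - θ k) • (x - y) := by
      simp only [shimojiAux]
      module
    rw [e]
    exact norm_convexComb_le (hθ k hk).1 (hθ k hk).2
      ((hT k hk _ (shimojiAux_mem hcv hTC hθ hx m _ hk') _
        (shimojiAux_mem hcv hTC hθ hy m _ hk')).trans (ih _ hk')) le_rfl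

theorem shimojiAux_fixed {C : Set H} {T : ℕ → H → H} {p : H} (hp : p ∈ commonFixedPoints C T)
    (θ : ℕ → ℝ) (m k : ℕ) (hk : 1 ≤ k) : shimojiAux T θ m k p = p := by
  induction m generalizing k with
  | zero => rfl
  | succ m ih =>
    rw [shimojiAux, ih (k + 1) (by omega), hp.2 k hk]
    module

/-- Induction on `k`. Since `U_k x - x = θ_k (T_k U_{k+1} x - x)`, dividing by the fixed `θ_k` gives
the second limit from the first. As `T_k` does not increase distances to `p`, `U_{k+1} x` is then
almost as far from `p` as `x` is. But it is a convex combination, with weight `θ_{k+1}` inside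
`(0,1)`, of `x` and a point no farther from `p`, so uniform convexity forces `U_{k+1} x - x → 0`. -/
theorem tendsto_shimojiU_sub {C : Set H} (hcv : Convex ℝ C) {T : ℕ → H → H}
    (hTC : ∀ i, 1 ≤ i → Set.MapsTo (T i) C C)
    (hT : ∀ i, 1 ≤ i → ∀ x ∈ C, ∀ y ∈ C, ‖T i x - T i y‖ ≤ ‖x - y‖) {θ : ℕ → ℝ}
    (hθ : ∀ i, 1 ≤ i → 0 < θ i ∧ θ i < 1) {p : H} (hp : p ∈ commonFixedPoints C T)
    {x : ℕ → H} (hx : ∀ n, x n ∈ C) {R : ℝ} (hR : ∀ n, ‖x n - p‖ ≤ R) {l : Filter ℕ}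
    (hl : l ≤ atTop) (hW : Tendsto (fun n => ‖shimojiW T θ n (x n) - x n‖) l (𝓝 0))
    (k : ℕ) (hk : 1 ≤ k) :
    Tendsto (fun n => ‖shimojiU T θ n k (x n) - x n‖) l (𝓝 0) ∧
    Tendsto (fun n => ‖T k (shimojiU T θ n (k + 1) (x n)) - x n‖) l (𝓝 0) := by
  have hθ' : ∀ i, 1 ≤ i → 0 ≤ θ i ∧ θ i ≤ 1 := fun i hi => ⟨(hθ i hi).1.le, (hθ i hi).2.le⟩
  have hstep : ∀ n j, j ≤ n → shimojiU T θ n j (x n) - x n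
      = θ j • (T j (shimojiU T θ n (j + 1) (x n)) - x n) := fun n j hj => by
    rw [shimojiU_of_le T θ hj]
    module
  have hfirst : ∀ j, 1 ≤ j → Tendsto (fun n => ‖shimojiU T θ n j (x n) - x n‖) l (𝓝 0) →
      Tendsto (fun n => ‖T j (shimojiU T θ n (j + 1) (x n)) - x n‖) l (𝓝 0) := by
    intro j hj h
    have h1 : Tendsto (fun n => (θ j)⁻¹ * ‖shimojiU T θ n j (x n) - x n‖) l (𝓝 0) := by
      simpa using h.const_mul (θ j)⁻¹
    refine h1.congr' ?_
    filter_upwards [hl (eventually_ge_atTop j)] with n hn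
    rw [hstep n j hn, norm_smul, Real.norm_of_nonneg (hθ j hj).1.le,
      inv_mul_cancel_left₀ (hθ j hj).1.ne']
  suffices h : Tendsto (fun n => ‖shimojiU T θ n k (x n) - x n‖) l (𝓝 0) from ⟨h, hfirst k hk h⟩
  induction k, hk using Nat.le_induction with
  | base => exact hW
  | succ k hk ih =>
    have hk1 : 1 ≤ k + 1 := by omega
    obtain ⟨ht0, ht1⟩ := hθ (k + 1) hk1
    set t := θ (k + 1) with ht
    -- The bound combines `‖u - x‖² = t² ‖v - x‖²` with `t(1-t) ‖v - x‖² ≤ ‖x - p‖² - ‖u - p‖² ≤ 2R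
    -- ‖T_k u - x‖`.
    have h1 : Tendsto (fun n => √(t / (1 - t) * (2 * R) *
        ‖T k (shimojiU T θ n (k + 1) (x n)) - x n‖)) l (𝓝 0) := by
      simpa using ((hfirst k hk ih).const_mul (t / (1 - t) * (2 * R))).sqrt
    refine squeeze_zero' (Eventually.of_forall fun n => norm_nonneg _) ?_ h1
    filter_upwards [hl (eventually_ge_atTop (k + 1))] with n hn
    refine Real.le_sqrt_of_sq_le ?_
    have hUC : ∀ j, 1 ≤ j → shimojiU T θ n j (x n) ∈ C := fun j hj =>
      shimojiAux_mem hcv hTC hθ' (hx n) _ j hj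
    have hUp : ∀ j, 1 ≤ j → ‖shimojiU T θ n j (x n) - p‖ ≤ ‖x n - p‖ := fun j hj => by
      have h := norm_shimojiAux_sub_le hcv hTC hT hθ' (hx n) hp.1 (n + 1 - j) j hj
      rwa [shimojiAux_fixed hp θ _ j hj] at h
    have hTp : ∀ j, 1 ≤ j → ∀ u ∈ C, ‖T j u - p‖ ≤ ‖u - p‖ := fun j hj u hu => by
      have h := hT j hj u hu p hp.1
      rwa [hp.2 j hj] at h
    set u := shimojiU T θ n (k + 1) (x n) with hu
    set v := T (k + 1) (shimojiU T θ n (k + 1 + 1) (x n)) with hv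
    have e1 : u - p = t • (v - p) + (1 - t) • (x n - p) := by
      rw [hu, shimojiU_of_le T θ hn, ← hv, ← ht]
      module
    have e2 : u - x n = t • (v - x n) := hstep n (k + 1) hn
    have e3 := norm_sq_convexComb t (v - p) (x n - p)
    rw [← e1, sub_sub_sub_cancel_right] at e3
    have e4 : ‖v - p‖ ≤ ‖x n - p‖ :=
      (hTp _ hk1 _ (hUC _ (by omega))).trans (hUp _ (by omega))
    have e5 : ‖u - x n‖ ^ 2 = t ^ 2 * ‖v - x n‖ ^ 2 := by
      rw [e2, norm_smul, Real.norm_of_nonneg ht0.le, mul_pow]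
    have e6 : ‖T k u - p‖ ≤ ‖u - p‖ := hTp k hk u (hUC _ hk1)
    have e7 : ‖x n - p‖ ≤ ‖T k u - x n‖ + ‖T k u - p‖ := by
      have := norm_sub_le_norm_sub_add_norm_sub (x n) (T k u) p
      rwa [norm_sub_rev (x n) (T k u)] at this
    have e8 : ‖x n - p‖ ^ 2 - ‖u - p‖ ^ 2 ≤ 2 * R * ‖T k u - x n‖ := by
      have a1 : ‖x n - p‖ - ‖u - p‖ ≤ ‖T k u - x n‖ := by linarith
      have a2 : ‖x n - p‖ + ‖u - p‖ ≤ 2 * R := by linarith [hUp _ hk1, hR n]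
      have a3 := mul_le_mul_of_nonneg_right a1
        (show 0 ≤ ‖x n - p‖ + ‖u - p‖ by positivity)
      have a4 := mul_le_mul_of_nonneg_left a2 (norm_nonneg (T k u - x n))
      nlinarith
    have e9 := mul_le_mul_of_nonneg_left (pow_le_pow_left₀ (norm_nonneg _) e4 2) ht0.le
    have e10 : t * (1 - t) * ‖v - x n‖ ^ 2 ≤ 2 * R * ‖T k u - x n‖ := by linarith
    have e11 := mul_le_mul_of_nonneg_left e10 ht0.le
    have h1t : 0 < 1 - t := by linarith
    rw [e5, div_mul_eq_mul_div, div_mul_eq_mul_div, le_div_iff₀ h1t]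
    linarith

theorem tendsto_sub_of_shimojiW {C : Set H} (hcv : Convex ℝ C) {T : ℕ → H → H}
    (hTC : ∀ i, 1 ≤ i → Set.MapsTo (T i) C C)
    (hT : ∀ i, 1 ≤ i → ∀ x ∈ C, ∀ y ∈ C, ‖T i x - T i y‖ ≤ ‖x - y‖) {θ : ℕ → ℝ}
    (hθ : ∀ i, 1 ≤ i → 0 < θ i ∧ θ i < 1) {p : H} (hp : p ∈ commonFixedPoints C T)
    {x : ℕ → H} (hx : ∀ n, x n ∈ C) {R : ℝ} (hR : ∀ n, ‖x n - p‖ ≤ R) {l : Filter ℕ}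
    (hl : l ≤ atTop) (hW : Tendsto (fun n => ‖shimojiW T θ n (x n) - x n‖) l (𝓝 0))
    (k : ℕ) (hk : 1 ≤ k) : Tendsto (fun n => ‖T k (x n) - x n‖) l (𝓝 0) := by
  have hθ' : ∀ i, 1 ≤ i → 0 ≤ θ i ∧ θ i ≤ 1 := fun i hi => ⟨(hθ i hi).1.le, (hθ i hi).2.le⟩
  have h1 := (tendsto_shimojiU_sub hcv hTC hT hθ hp hx hR hl hW (k + 1) (by omega)).1
  have h2 := (tendsto_shimojiU_sub hcv hTC hT hθ hp hx hR hl hW k hk).2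
  refine squeeze_zero (fun n => norm_nonneg _) (fun n => ?_) (by simpa using h1.add h2)
  refine (norm_sub_le_norm_sub_add_norm_sub _ (T k (shimojiU T θ n (k + 1) (x n))) _).trans
    (add_le_add_left ?_ _)
  rw [norm_sub_rev (shimojiU T θ n (k + 1) (x n))]
  exact hT k hk _ (hx n) _ (shimojiAux_mem hcv hTC hθ' (hx n) _ _ (by omega))

end Shimoji

/-- If the bound failed frequently, an ultrafilter would live on the failures. There `c η ≤ α B`, so
`η → 0`, and the hypothesis on ultrafilters then makes `τ ≤ ε` somewhere on the failure set, a
contradiction. -/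
theorem eventually_mul_sub_le {α τ η : ℕ → ℝ} {B c : ℝ} (hα0 : ∀ n, 0 ≤ α n)
    (hα : Tendsto α atTop (𝓝 0)) (hτ : ∀ n, τ n ≤ B) (hη : ∀ n, 0 ≤ η n) (hc : 0 < c)
    (hU : ∀ U : Ultrafilter ℕ, (U : Filter ℕ) ≤ atTop → Tendsto η U (𝓝 0) →
      ∀ ε > 0, ∀ᶠ n in U, τ n ≤ ε) {ε : ℝ} (hε : 0 < ε) :
    ∀ᶠ n in atTop, α n * τ n - c * η n ≤ α n * ε := by
  by_contra hcon
  rw [not_eventually] at hcon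
  have hne : (atTop ⊓ 𝓟 {n | ¬ (α n * τ n - c * η n ≤ α n * ε)}).NeBot :=
    frequently_iff_neBot.1 hcon
  set U := Ultrafilter.of (atTop ⊓ 𝓟 {n | ¬ (α n * τ n - c * η n ≤ α n * ε)})
  have hUle := Ultrafilter.of_le (atTop ⊓ 𝓟 {n | ¬ (α n * τ n - c * η n ≤ α n * ε)})
  have hUtop : (U : Filter ℕ) ≤ atTop := hUle.trans inf_le_left
  have hUbad : ∀ᶠ n in (U : Filter ℕ), ¬ (α n * τ n - c * η n ≤ α n * ε) :=
    le_principal_iff.1 (hUle.trans inf_le_right)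
  have hη0 : Tendsto η U (𝓝 0) := by
    have h1 : Tendsto (fun n => α n * B / c) U (𝓝 0) := by
      simpa using ((hα.mono_left hUtop).mul_const B).div_const c
    refine squeeze_zero' (Eventually.of_forall hη) ?_ h1
    filter_upwards [hUbad] with n hn
    rw [le_div_iff₀ hc]
    have h2 := mul_le_mul_of_nonneg_left (hτ n) (hα0 n)
    have h3 := mul_nonneg (hα0 n) hε.le
    linarith
  obtain ⟨n, hn1, hn2⟩ := (hUbad.and (hU U hUtop hη0 ε hε)).exists
  have h2 := mul_le_mul_of_nonneg_left hn2 (hα0 n)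
  have h3 := mul_nonneg hc.le (hη n)
  exact hn1 (by linarith)

/-! ### Estimates for one step of the iteration. -/

section StronglyPositive

variable {H : Type*} [NormedAddCommGroup H] [InnerProductSpace ℝ H]

/-- `A` need not be self-adjoint, so the norm is not read off the quadratic form. Expanding the
square instead leaves a term `t²‖A‖²`, which the slack `κ - g` absorbs when `t` is small. -/
theorem norm_smul_sub_smul_le {A : H →L[ℝ] H} {κ : ℝ}
    (hA : ∀ x : H, κ * ‖x‖ ^ 2 ≤ inner ℝ (A x) x) {r t g : ℝ} (hr : 0 ≤ r) (ht : 0 ≤ t)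
    (hrt : t * g ≤ r) (htA : t * ‖A‖ ^ 2 ≤ 2 * r * (κ - g)) (h : H) :
    ‖r • h - t • A h‖ ≤ (r - t * g) * ‖h‖ := by
  refine (abs_le_of_sq_le_sq' ?_ (mul_nonneg (sub_nonneg.2 hrt) (norm_nonneg h))).2
  rw [norm_sub_sq_real, norm_smul, norm_smul, real_inner_smul_left, real_inner_smul_right,
    Real.norm_of_nonneg hr, Real.norm_of_nonneg ht, real_inner_comm]
  have h1 := pow_le_pow_left₀ (norm_nonneg _) (A.le_opNorm h) 2
  have h2 := mul_le_mul_of_nonneg_left h1 (sq_nonneg t)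
  have h3 := mul_le_mul_of_nonneg_left (hA h) (mul_nonneg hr ht)
  have h4 := mul_le_mul_of_nonneg_left htA (mul_nonneg ht (sq_nonneg ‖h‖))
  have h5 := sq_nonneg (t * g * ‖h‖)
  nlinarith

/-- Replacing the convex combination by `X` in the cross term costs at most `‖w‖ ‖X - Y‖`; the
negative term of the convexity identity is kept for later absorption. -/
theorem norm_sq_convexComb_add_smul_le {s t : ℝ} (hs0 : 0 ≤ s) (hs1 : s ≤ 1) (ht : 0 ≤ t)
    {X Y : H} (hYX : ‖Y‖ ≤ ‖X‖) (w : H) :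
    ‖s • X + (1 - s) • Y + t • w‖ ^ 2 ≤ ‖X‖ ^ 2 - s * (1 - s) * ‖X - Y‖ ^ 2
      + t * (2 * inner ℝ w X + 2 * ‖w‖ * ‖X - Y‖ + t * ‖w‖ ^ 2) := by
  have hs : 0 ≤ 1 - s := sub_nonneg.2 hs1
  rw [norm_add_sq_real, norm_sq_convexComb, real_inner_smul_right, norm_smul,
    Real.norm_of_nonneg ht, real_inner_comm]
  have e : s • X + (1 - s) • Y = X - (1 - s) • (X - Y) := by module
  rw [e, inner_sub_right, real_inner_smul_right]
  have h1 := (abs_le.1 (abs_real_inner_le_norm w (X - Y))).1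
  have h2 : -(‖w‖ * ‖X - Y‖) ≤ (1 - s) * inner ℝ w (X - Y) := by
    have h3 := mul_le_mul_of_nonneg_left h1 hs
    have h4 : 0 ≤ s * (‖w‖ * ‖X - Y‖) := by positivity
    linarith
  have h5 := mul_le_mul_of_nonneg_left h2 ht
  have h6 := mul_le_mul_of_nonneg_left (pow_le_pow_left₀ (norm_nonneg _) hYX 2) hs
  nlinarith

end StronglyPositive

/-! ### The convergence theorem. -/

theorem mainTheorem1 {H : Type*} [NormedAddCommGroup H] [InnerProductSpace ℝ H] [CompleteSpace H]
    (C : Set H) (hCclosed : IsClosed C) (hCconvex : Convex ℝ C)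
    -- `f` is a contraction of `C` into itself with constant `a`
    (f : H → H) (hfC : Set.MapsTo f C C) (a : ℝ) (ha0 : 0 < a) (ha1 : a < 1)
    (hf : ∀ x ∈ C, ∀ y ∈ C, ‖f x - f y‖ ≤ a * ‖x - y‖)
    -- `A` is a strongly positive bounded linear operator with coefficient `γbar`
    (A : H →L[ℝ] H) (γbar : ℝ) (hγbar : 0 < γbar)
    (hA : ∀ x : H, γbar * ‖x‖ ^ 2 ≤ inner ℝ (A x) x)
    (γ : ℝ) (hγ0 : 0 < γ) (hγ1 : γ < γbar / a)
    -- nonexpansive self-maps `T_1, T_2, …` of `C` with a common fixed point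
    (T : ℕ → H → H) (hTC : ∀ i, 1 ≤ i → Set.MapsTo (T i) C C)
    (hT : ∀ i, 1 ≤ i → ∀ x ∈ C, ∀ y ∈ C, ‖T i x - T i y‖ ≤ ‖x - y‖)
    (hF : (commonFixedPoints C T).Nonempty)
    -- the weights of the `W_n`-mappings
    (θ : ℕ → ℝ) (b : ℝ) (hb : b < 1) (hθ : ∀ i, 1 ≤ i → 0 < θ i ∧ θ i ≤ b)
    -- the parameters of the iteration (`γs n` is the parameter `γ_n`)
    (α β γs δ : ℕ → ℝ)
    (hα : ∀ n, α n ∈ Set.Icc (0 : ℝ) 1) (hβ : ∀ n, β n ∈ Set.Icc (0 : ℝ) 1)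
    (hγs : ∀ n, γs n ∈ Set.Icc (0 : ℝ) 1) (hδ : ∀ n, δ n ∈ Set.Icc (0 : ℝ) 1)
    (hC1 : Tendsto α atTop (𝓝 0))
    (hC1' : Tendsto (fun N => ∑ n ∈ Finset.Icc 1 N, α n) atTop atTop)
    (hC2 : 0 < liminf δ atTop) (hC2' : limsup δ atTop < 1)
    (hC3 : Summable fun n => |γs (n + 1) - γs n|)
    (hC4 : Summable fun n => |α (n + 1) - α n|)
    (hC5 : Summable fun n => |β (n + 1) - β n|)
    (d : ℝ) (hd0 : 0 < d) (hd1 : d < 1) (hC6 : ∀ n, d < (1 + β n) * γs n - 2 * β n)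
    -- the iteration
    (x y z : ℕ → H) (hx0 : x 0 ∈ C)
    (hz : ∀ n, z n = γs n • x n + (1 - γs n) • shimojiW T θ n (x n))
    (hy : ∀ n, y n = β n • x n + (1 - β n) • shimojiW T θ n (z n))
    (hx : ∀ n, x (n + 1) = metricProj C
      (α n • γ • f (x n) + δ n • x n + ((1 - δ n) • y n - α n • A (y n)))) :
    ∃ q ∈ commonFixedPoints C T,
      (∀ p ∈ commonFixedPoints C T, inner ℝ (γ • f q - A q) (p - q) ≤ 0) ∧
      (∀ q' ∈ commonFixedPoints C T,
        (∀ p ∈ commonFixedPoints C T, inner ℝ (γ • f q' - A q') (p - q') ≤ 0) → q' = q) ∧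
      Tendsto x atTop (𝓝 q) := by
  have hθ' : ∀ i, 1 ≤ i → 0 < θ i ∧ θ i < 1 := fun i hi => ⟨(hθ i hi).1, (hθ i hi).2.trans_lt hb⟩
  have hθ'' : ∀ i, 1 ≤ i → 0 ≤ θ i ∧ θ i ≤ 1 := fun i hi => ⟨(hθ' i hi).1.le, (hθ' i hi).2.le⟩
  have hWC : ∀ n, ∀ u ∈ C, shimojiW T θ n u ∈ C := fun n u hu =>
    shimojiAux_mem hCconvex hTC hθ'' hu _ 1 le_rfl
  have hWne : ∀ n, ∀ u ∈ C, ∀ v ∈ C, ‖shimojiW T θ n u - shimojiW T θ n v‖ ≤ ‖u - v‖ :=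
    fun n u hu v hv => norm_shimojiAux_sub_le hCconvex hTC hT hθ'' hu hv _ 1 le_rfl
  have hm : 0 < γbar - γ * a := sub_pos.2 ((lt_div_iff₀ ha0).1 hγ1)
  set m := γbar - γ * a with hmdef
  have hFC : commonFixedPoints C T ⊆ C := fun _ h => h.1
  have hmono : ∀ u ∈ C, ∀ v ∈ C,
      m * ‖u - v‖ ^ 2 ≤ inner ℝ (A u - γ • f u - (A v - γ • f v)) (u - v) := by
    intro u hu v hv
    have e : A u - γ • f u - (A v - γ • f v) = A (u - v) - γ • (f u - f v) := by
      rw [map_sub]; module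
    rw [e, inner_sub_left, real_inner_smul_left]
    have h1 := hA (u - v)
    have h2 := real_inner_le_norm (f u - f v) (u - v)
    have h3 := mul_le_mul_of_nonneg_right (hf u hu v hv) (norm_nonneg (u - v))
    have h4 := mul_le_mul_of_nonneg_left (h2.trans h3) hγ0.le
    rw [hmdef]
    linarith
  -- The extra `m` in the constant only secures `m ≤ L`.
  have hlip : ∀ u ∈ C, ∀ v ∈ C,
      ‖A u - γ • f u - (A v - γ • f v)‖ ≤ (‖A‖ + γ * a + m) * ‖u - v‖ := by
    intro u hu v hv
    have e : A u - γ • f u - (A v - γ • f v) = A (u - v) - γ • (f u - f v) := by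
      rw [map_sub]; module
    rw [e]
    have h1 := A.le_opNorm (u - v)
    have h2 := mul_le_mul_of_nonneg_left (hf u hu v hv) hγ0.le
    have h3 := norm_sub_le (A (u - v)) (γ • (f u - f v))
    rw [norm_smul, Real.norm_of_nonneg hγ0.le] at h3
    have h4 := mul_nonneg hm.le (norm_nonneg (u - v))
    linarith
  obtain ⟨q, hqF, hq⟩ := exists_variational_solution hF (isClosed_commonFixedPoints hCclosed hT)
    (convex_commonFixedPoints hCconvex hT) (fun u => A u - γ • f u) hm
    (by have : 0 ≤ ‖A‖ + γ * a := by positivity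
        linarith : m ≤ ‖A‖ + γ * a + m)
    (fun u hu v hv => hmono u (hFC hu) v (hFC hv)) (fun u hu v hv => hlip u (hFC hu) v (hFC hv))
  set e := γ • f q - A q with he
  have hq' : ∀ p ∈ commonFixedPoints C T, inner ℝ e (p - q) ≤ 0 := fun p hp => by
    have h := hq p hp
    rw [← neg_sub (γ • f q), inner_neg_left] at h
    exact Left.nonneg_neg_iff.1 h
  refine ⟨q, hqF, hq', fun q' hq'F h' => ?_, ?_⟩
  · have h1 := h' q hqF
    have h2 := hq q' hq'F
    have h3 := hmono q' hq'F.1 q hqF.1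
    have h4 : inner ℝ (A q' - γ • f q') (q' - q) ≤ 0 := by
      rwa [← neg_sub (γ • f q'), ← neg_sub q q', inner_neg_neg]
    rw [inner_sub_left] at h3
    have h5 : m * ‖q' - q‖ ^ 2 ≤ 0 := by linarith
    have h6 : ‖q' - q‖ ^ 2 ≤ 0 := nonpos_of_mul_nonpos_right h5 hm
    exact sub_eq_zero.1 (norm_eq_zero.1
      (pow_eq_zero_iff two_ne_zero |>.1 (le_antisymm h6 (sq_nonneg _))))
  have hxC : ∀ n, x n ∈ C := by
    rintro (_ | n)
    · exact hx0
    · rw [hx]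
      exact metricProj_mem ⟨_, hx0⟩ hCclosed hCconvex _
  have hzC : ∀ n, z n ∈ C := fun n => by
    rw [hz]
    exact hCconvex (hxC n) (hWC n _ (hxC n)) (hγs n).1 (sub_nonneg.2 (hγs n).2)
      (add_sub_cancel _ _)
  have hWq : ∀ n, ∀ u ∈ C, ‖shimojiW T θ n u - q‖ ≤ ‖u - q‖ := fun n u hu => by
    have h := hWne n u hu q hqF.1
    rwa [show shimojiW T θ n q = q from shimojiAux_fixed hqF θ _ 1 le_rfl] at h
  have hzq : ∀ n, ‖z n - q‖ ≤ ‖x n - q‖ := fun n => by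
    have e1 : z n - q = γs n • (x n - q) + (1 - γs n) • (shimojiW T θ n (x n) - q) := by
      rw [hz]; module
    rw [e1]
    exact norm_convexComb_le (hγs n).1 (hγs n).2 le_rfl (hWq n _ (hxC n))
  have hyq : ∀ n, ‖y n - q‖ ≤ ‖x n - q‖ := fun n => by
    have e1 : y n - q = β n • (x n - q) + (1 - β n) • (shimojiW T θ n (z n) - q) := by
      rw [hy]; module
    rw [e1]
    exact norm_convexComb_le (hβ n).1 (hβ n).2 le_rfl ((hWq n _ (hzC n)).trans (hzq n))
  have hfq : ∀ n, ‖γ • (f (x n) - f q)‖ ≤ γ * a * ‖x n - q‖ := fun n => by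
    rw [norm_smul, Real.norm_of_nonneg hγ0.le, mul_assoc]
    exact mul_le_mul_of_nonneg_left (hf _ (hxC n) _ hqF.1) hγ0.le
  -- bounds on `δ`
  have hδb : IsBoundedUnder (· ≥ ·) atTop δ := isBoundedUnder_of ⟨0, fun n => (hδ n).1⟩
  have hδb' : IsBoundedUnder (· ≤ ·) atTop δ := isBoundedUnder_of ⟨1, fun n => (hδ n).2⟩
  obtain ⟨c₁, hc₁, hc₁'⟩ := exists_between hC2
  obtain ⟨c₂, hc₂, hc₂'⟩ := exists_between hC2'
  have hδ1 : ∀ᶠ n in atTop, c₁ < δ n := eventually_lt_of_lt_liminf hc₁' hδb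
  have hδ2 : ∀ᶠ n in atTop, δ n < c₂ := eventually_lt_of_limsup_lt hc₂ hδb'
  -- boundedness of the iterates
  obtain ⟨R, hR⟩ : ∃ R, ∀ n, ‖x n - q‖ ≤ R := by
    have hα1 : ∀ᶠ n in atTop, α n * (γbar - m / 2) < 1 - c₂ := by
      have h1 := hC1.mul_const (γbar - m / 2)
      rw [zero_mul] at h1
      exact h1.eventually_lt_const (sub_pos.2 hc₂')
    have hα2 : ∀ᶠ n in atTop, α n * ‖A‖ ^ 2 < (1 - c₂) * m := by
      have h1 := hC1.mul_const (‖A‖ ^ 2)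
      rw [zero_mul] at h1
      exact h1.eventually_lt_const (mul_pos (sub_pos.2 hc₂') hm)
    obtain ⟨N, hN⟩ := eventually_atTop.1 (hδ2.and (hα1.and hα2))
    -- Half of `m` is spent on the quadratic term of `A`; the other half leaves the contraction
    -- factor `1 - α_n m/2`, which preserves any radius at least `‖e‖ / (m/2)`.
    set R := max ‖x N - q‖ (‖e‖ / (m / 2)) with hRdef
    have hR0 : 0 ≤ R := (norm_nonneg _).trans (le_max_left _ _)
    have heR : ‖e‖ ≤ R * (m / 2) := (div_le_iff₀ (half_pos hm)).1 (le_max_right _ _)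
    have key : ∀ n, N ≤ n → ‖x n - q‖ ≤ R := by
      intro n hn
      induction n, hn using Nat.le_induction with
      | base => exact le_max_left _ _
      | succ n hn ih =>
        obtain ⟨h1, h2, h3⟩ := hN n hn
        rw [hx]
        refine (norm_metricProj_sub_le_of_mem hCclosed hCconvex _ hqF.1).trans ?_
        have e1 : α n • γ • f (x n) + δ n • x n + ((1 - δ n) • y n - α n • A (y n)) - q
            = α n • (γ • (f (x n) - f q) + e) + δ n • (x n - q)
              + ((1 - δ n) • (y n - q) - α n • A (y n - q)) := by
          rw [he, map_sub]; module
        have h4 := norm_smul_sub_smul_le hA (sub_nonneg.2 (hδ n).2) (hα n).1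
          (by linarith : α n * (γbar - m / 2) ≤ 1 - δ n)
          (by
            have := mul_le_mul_of_nonneg_right h1.le hm.le
            linarith : α n * ‖A‖ ^ 2 ≤ 2 * (1 - δ n) * (γbar - (γbar - m / 2))) (y n - q)
        have h5 := mul_le_mul_of_nonneg_left (hyq n)
          (by linarith : 0 ≤ 1 - δ n - α n * (γbar - m / 2))
        have h6 := (norm_add_le (γ • (f (x n) - f q)) e).trans (add_le_add_left (hfq n) _)
        have h7 := mul_le_mul_of_nonneg_left h6 (hα n).1
        rw [e1]
        refine (norm_add₃_le).trans ?_
        rw [norm_smul, norm_smul, Real.norm_of_nonneg (hα n).1, Real.norm_of_nonneg (hδ n).1]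
        have h8 : γbar - m / 2 = γ * a + m / 2 := by rw [hmdef]; ring
        rw [h8] at h4 h5 h2
        have h9 : α n * (m / 2) ≤ 1 := by
          have : 0 ≤ α n * (γ * a) := mul_nonneg (hα n).1 (by positivity)
          linarith [(hδ n).1]
        have h10 := mul_le_mul_of_nonneg_left ih (sub_nonneg.2 h9)
        have h11 := mul_le_mul_of_nonneg_left heR (hα n).1
        linarith
    refine ⟨R + ∑ i ∈ Finset.range N, ‖x i - q‖, fun n => ?_⟩
    rcases le_or_gt N n with hn | hn
    · exact (key n hn).trans (le_add_of_nonneg_right (Finset.sum_nonneg fun _ _ => norm_nonneg _))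
    · have := Finset.single_le_sum (f := fun i => ‖x i - q‖) (fun _ _ => norm_nonneg _)
        (Finset.mem_range.2 hn)
      linarith
  have hR0 : 0 ≤ R := (norm_nonneg _).trans (hR 0)
  -- the recursion for `‖x n - q‖ ^ 2`
  set M := γ * a * R + ‖e‖ + ‖A‖ * R with hM
  have hM0 : 0 ≤ M := by positivity
  set τ : ℕ → ℝ := fun n =>
    2 * inner ℝ e (x n - q) + (2 * ‖A‖ * R + 2 * M) * ‖x n - y n‖ + α n * M ^ 2 with hτ
  have hrec : ∀ n, ‖x (n + 1) - q‖ ^ 2 ≤ (1 - 2 * m * α n) * ‖x n - q‖ ^ 2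
      - δ n * (1 - δ n) * ‖x n - y n‖ ^ 2 + α n * τ n := by
    intro n
    set w := γ • f (x n) - A (y n) with hw
    have e1 : α n • γ • f (x n) + δ n • x n + ((1 - δ n) • y n - α n • A (y n)) - q
        = δ n • (x n - q) + (1 - δ n) • (y n - q) + α n • w := by
      rw [hw]; module
    have h1 := norm_metricProj_sub_le_of_mem hCclosed hCconvex
      (α n • γ • f (x n) + δ n • x n + ((1 - δ n) • y n - α n • A (y n))) hqF.1
    rw [← hx, e1] at h1
    have h2 := norm_sq_convexComb_add_smul_le (hδ n).1 (hδ n).2 (hα n).1 (hyq n) w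
    rw [sub_sub_sub_cancel_right] at h2
    have h3 := (pow_le_pow_left₀ (norm_nonneg _) h1 2).trans h2
    have hwM : ‖w‖ ≤ M := by
      have e2 : w = γ • (f (x n) - f q) + e - A (y n - q) := by rw [hw, he, map_sub]; module
      rw [e2]
      have h4 := norm_sub_le (γ • (f (x n) - f q) + e) (A (y n - q))
      have h5 := norm_add_le (γ • (f (x n) - f q)) e
      have h6 := (hfq n).trans
        (mul_le_mul_of_nonneg_left (hR n) (by positivity : 0 ≤ γ * a))
      have h7 := (A.le_opNorm (y n - q)).trans
        (mul_le_mul_of_nonneg_left ((hyq n).trans (hR n)) (norm_nonneg A))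
      linarith
    have hwX : inner ℝ w (x n - q) ≤ inner ℝ e (x n - q) - m * ‖x n - q‖ ^ 2
        + ‖A‖ * R * ‖x n - y n‖ := by
      have e2 : w = e - (A (x n) - γ • f (x n) - (A q - γ • f q)) + A (x n - y n) := by
        rw [hw, he, map_sub]; module
      rw [e2, inner_add_left, inner_sub_left e]
      have h4 := hmono _ (hxC n) _ hqF.1
      have h5 := real_inner_le_norm (A (x n - y n)) (x n - q)
      have h6 := mul_le_mul (A.le_opNorm (x n - y n)) (hR n) (norm_nonneg _) (by positivity)
      linarith
    have h4 : 2 * inner ℝ w (x n - q) + 2 * ‖w‖ * ‖x n - y n‖ + α n * ‖w‖ ^ 2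
        ≤ τ n - 2 * m * ‖x n - q‖ ^ 2 := by
      have h5 := mul_le_mul_of_nonneg_right hwM (norm_nonneg (x n - y n))
      have h6 := mul_le_mul_of_nonneg_left (pow_le_pow_left₀ (norm_nonneg _) hwM 2) (hα n).1
      simp only [hτ]
      linarith
    have h7 := mul_le_mul_of_nonneg_left h4 (hα n).1
    linarith
  have hτB : ∀ n, τ n ≤ 2 * (‖e‖ * R) + (2 * ‖A‖ * R + 2 * M) * (2 * R) + M ^ 2 := by
    intro n
    have h1 := (real_inner_le_norm e (x n - q)).trans
      (mul_le_mul_of_nonneg_left (hR n) (norm_nonneg e))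
    have h2 : ‖x n - y n‖ ≤ 2 * R := by
      have h3 := norm_sub_le (x n - q) (y n - q)
      rw [sub_sub_sub_cancel_right] at h3
      linarith [hR n, hyq n]
    have h4 := mul_le_mul_of_nonneg_left h2 (by positivity : 0 ≤ 2 * ‖A‖ * R + 2 * M)
    have h5 := mul_le_mul_of_nonneg_right (hα n).2 (sq_nonneg M)
    simp only [hτ]
    linarith
  -- (C6) forces both `γ_n ≥ d` and `1 - β_n ≥ d`. Nonexpansiveness gives `γ_n ‖W_n x_n - x_n‖ ≤
  -- ‖x_n - W_n z_n‖`, and `x_n - y_n` is `1 - β_n` times `x_n - W_n z_n`.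
  have hWx : ∀ n, ‖shimojiW T θ n (x n) - x n‖ ≤ ‖x n - y n‖ / d ^ 2 := by
    intro n
    set u := shimojiW T θ n (x n) with hu
    have e1 : x n - y n = (1 - β n) • (x n - shimojiW T θ n (z n)) := by rw [hy]; module
    have e2 : x n - z n = (1 - γs n) • (x n - u) := by rw [hz]; module
    have h1 := norm_sub_le_norm_sub_add_norm_sub u (shimojiW T θ n (z n)) (x n)
    have h2 := hWne n _ (hxC n) _ (hzC n)
    rw [e2, norm_smul, Real.norm_of_nonneg (sub_nonneg.2 (hγs n).2), norm_sub_rev (x n) u,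
      ← hu] at h2
    rw [norm_sub_rev (shimojiW T θ n (z n)) (x n)] at h1
    have h3 : γs n * ‖u - x n‖ ≤ ‖x n - shimojiW T θ n (z n)‖ := by linarith
    have hβ0 := (hβ n).1
    have hγ1' := (hγs n).2
    have h5 : d ≤ 1 - β n := by nlinarith [hC6 n]
    have h6 : d ≤ γs n := by nlinarith [hC6 n]
    rw [le_div_iff₀ (by positivity), e1, norm_smul, Real.norm_of_nonneg (hd0.le.trans h5)]
    have h7 := mul_le_mul h5 ((mul_le_mul_of_nonneg_right h6 (norm_nonneg _)).trans h3)
      (by positivity) (hd0.le.trans h5)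
    linarith
  have hultra : ∀ U : Ultrafilter ℕ, (U : Filter ℕ) ≤ atTop →
      Tendsto (fun n => ‖x n - y n‖ ^ 2) U (𝓝 0) → ∀ ε > 0, ∀ᶠ n in U, τ n ≤ ε := by
    intro U hU hη ε hε
    have hxy : Tendsto (fun n => ‖x n - y n‖) U (𝓝 0) := by
      simpa using hη.sqrt
    have hWxU : Tendsto (fun n => ‖shimojiW T θ n (x n) - x n‖) U (𝓝 0) :=
      squeeze_zero (fun n => norm_nonneg _) hWx (by simpa using hxy.div_const (d ^ 2))
    have hxR : ∀ n, ‖x n‖ ≤ R + ‖q‖ := fun n => by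
      have := norm_add_le (x n - q) q
      rw [sub_add_cancel] at this
      linarith [hR n]
    obtain ⟨p, hp⟩ := exists_weak_limit_ultrafilter U x hxR
    have hpC : p ∈ C := mem_of_weak_limit hCclosed hCconvex hxC hp
    have hpF : p ∈ commonFixedPoints C T := ⟨hpC, fun i hi =>
      fixed_of_weak_limit hxR (fun n => hT i hi _ (hxC n) _ hpC)
        (tendsto_sub_of_shimojiW hCconvex hTC hT hθ' hqF hxC hR hU hWxU i hi) hp⟩
    have h1 : Tendsto τ U (𝓝 (2 * (inner ℝ p e - inner ℝ q e)
        + (2 * ‖A‖ * R + 2 * M) * 0 + 0 * M ^ 2)) := by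
      refine (((((hp e).sub_const _).const_mul 2).add (hxy.const_mul _)).add
        ((hC1.mono_left hU).mul_const _)).congr fun n => ?_
      simp only [hτ]
      rw [← inner_sub_left, real_inner_comm]
    rw [← inner_sub_left, real_inner_comm, mul_zero, zero_mul, add_zero, add_zero] at h1
    exact h1.eventually_le_const (by linarith [hq' p hpF])
  have hcc : 0 < c₁ * (1 - c₂) := mul_pos hc₁ (sub_pos.2 hc₂')
  have hfinal : Tendsto (fun n => ‖x n - q‖ ^ 2) atTop (𝓝 0) := by
    refine tendsto_zero_of_eventually_le (a := fun n => 2 * m * α n)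
      (fun n => sq_nonneg _) ?_ ?_ fun ε hε => ?_
    · have h1 := hC1.const_mul (2 * m)
      rw [mul_zero] at h1
      exact h1.eventually_le_const one_pos
    · simp only [← Finset.mul_sum]
      refine Tendsto.const_mul_atTop (by positivity) ?_
      -- The shift makes `range (N + 1)` contain `Icc 1 N`; the additional term `α 0` is
      -- nonnegative.
      rw [← tendsto_add_atTop_iff_nat 1]
      refine tendsto_atTop_mono (fun N => ?_) hC1'
      refine Finset.sum_le_sum_of_subset_of_nonneg (fun i hi => ?_) fun i _ _ => (hα i).1
      rw [Finset.mem_Icc] at hi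
      exact Finset.mem_range.2 (by omega)
    -- Eventually `δ_n(1 - δ_n) ≥ c₁(1 - c₂)`, and the tolerance `2mε` matches the contraction rate
    -- `2mα_n`.
    · filter_upwards [hδ1, hδ2, eventually_mul_sub_le (fun n => (hα n).1) hC1 hτB
        (fun n => sq_nonneg ‖x n - y n‖) hcc hultra (by positivity : 0 < 2 * m * ε)]
        with n h1 h2 h3
      have h4 := mul_le_mul_of_nonneg_right
        (mul_le_mul h1.le (by linarith : 1 - c₂ ≤ 1 - δ n) (by linarith) (hδ n).1)
        (sq_nonneg ‖x n - y n‖)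
      linarith [hrec n]
  rw [tendsto_iff_norm_sub_tendsto_zero]
  simpa using hfinal.sqrt
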